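/- Let $\mathcal X,\mathcal Y\subseteq\mathbb R^d$ be measurable, $\sigma>0$, and let $\mathcal P(\cdot)$ denote the Borel probability measures with the weak topology and $\mathcal P_{ac}(\cdot)$ those with a Lebesgue density (also identified with that density). Let $\pi\propto e^{-U^\pi}$ and $\rho\propto e^{-U^\rho}$ be reference probability densities on $\mathcal X$, $\mathcal Y$, with $U^\pi:\mathcal X\to\mathbb R$ and $U^\rho:\mathcal Y\to\mathbb R$ measurable. A function $G:\mathcal P(\mathcal M)\to\mathbb R$ has flat derivative $\frac{\delta G}{\delta m}:\mathcal P(\mathcal M)\times\mathcal M\to\mathbb R$ if the latter is jointly continuous, bounded in $x$ for each $m$, satisfies $G(m')-G(m)=\int_0^1\int_{\mathcal M}\frac{\delta G}{\delta m}(m+\varepsilon(m'-m),x)\,(m'-m)(dx)\,d\varepsilon$ for all $m,m'$, and is normalized by $\int_{\mathcal M}\frac{\delta G}{\delta m}(m,x)\,m(dx)=0$. Let $F:\mathcal P(\mathcal X)\times\mathcal P(\mathcal Y)\to\mathbb R$. Assume that (i) $F$ has flat derivatives in $\nu$ and in $\mu$ with $|\frac{\delta F}{\delta\nu}(\nu,\mu,x)|\le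 C_\nu$ and $|\frac{\delta F}{\delta\mu}(\nu,\mu,y)|\le C_\mu$ for all arguments, where $C_\nu,C_\mu>0$; (ii) the four second order flat derivatives $\frac{\delta^2F}{\delta\nu^2},\frac{\delta^2F}{\delta\mu^2},\frac{\delta^2F}{\delta\nu\delta\mu},\frac{\delta^2F}{\delta\mu\delta\nu}$ (the flat derivatives in $\nu$ and in $\mu$ of $\frac{\delta F}{\delta\nu}(\nu,\mu,x)$ for fixed $x$ and of $\frac{\delta F}{\delta\mu}(\nu,\mu,y)$ for fixed $y$) exist and are bounded; (iii) $(\nu_0,\mu_0)\in\mathcal P_{ac}(\mathcal X)\times\mathcal P_{ac}(\mathcal Y)$ satisfy $r_\nu\le\nu_0(x)/\pi(x)\le R_\nu$ and $r_\mu\le\mu_0(y)/\rho(y)\le R_\mu$ for all $x\in\mathcal X$, $y\in\mathcal Y$, where $r_\nu,r_\mu>0$ and $R_\nu,R_\mu>1$. Put $a(\nu,\mu,x)=\frac{\delta F}{\delta\nu}(\nu,\mu,x)+\frac{\sigma^2}2\log\frac{\nu(x)}{\pi(x)}-\frac{\sigma^2}2\mathrm{KL}(\nu|\pi)$ and $b(\nu,\mu,y)=\frac{\delta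 F}{\delta\mu}(\nu,\mu,y)-\frac{\sigma^2}2\log\frac{\mu(y)}{\rho(y)}+\frac{\sigma^2}2\mathrm{KL}(\mu|\rho)$, and let $(\nu_t,\mu_t)_{t\ge0}$ in $\mathcal P_{ac}(\mathcal X)\times\mathcal P_{ac}(\mathcal Y)$ be a solution, started at $(\nu_0,\mu_0)$, of the Fisher-Rao flow $\partial_t\nu_t(x)=-a(\nu_t,\mu_t,x)\,\nu_t(x)$, $\partial_t\mu_t(y)=b(\nu_t,\mu_t,y)\,\mu_t(y)$ (classically in $t\ge0$ for every $x\in\mathcal X$, $y\in\mathcal Y$). Then there is a constant $C_\sigma>0$, depending only on $\sigma,C_\nu,C_\mu,r_\nu,r_\mu,R_\nu,R_\mu$, with $|a(\nu_t,\mu,x)|\le C_\sigma$ and $|b(\nu,\mu_t,y)|\le C_\sigma$ for all $t\ge0$, $\nu\in\mathcal P(\mathcal X)$, $\mu\in\mathcal P(\mathcal Y)$, $x\in\mathcal X$, $y\in\mathcal Y$, such that the following holds. 1. For all $(\nu,\mu)\in\mathcal P_{ac}(\mathcal X)\times\mathcal P_{ac}(\mathcal Y)$ the function $t\mapsto\mathrm{KL}(\nu|\nu_t)+\mathrm{KL}(\mu|\mu_t)$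 is either finite for all $t\ge0$ or infinite for all $t\ge0$, and in the first case it is differentiable on $[0,\infty)$. 2. Suppose moreover that $F$ is convex-concave: $F(\nu',\mu)-F(\nu,\mu)\ge\int\frac{\delta F}{\delta\nu}(\nu,\mu,x)(\nu'-\nu)(dx)$ and $F(\nu,\mu')-F(\nu,\mu)\le\int\frac{\delta F}{\delta\mu}(\nu,\mu,y)(\mu'-\mu)(dy)$ for all $\nu,\nu'\in\mathcal P(\mathcal X)$ and $\mu,\mu'\in\mathcal P(\mathcal Y)$. Let $V^\sigma(\nu,\mu)=F(\nu,\mu)+\frac{\sigma^2}2(\mathrm{KL}(\nu|\pi)-\mathrm{KL}(\mu|\rho))$, let $(\nu^*,\mu^*)$ be a mixed Nash equilibrium, i.e. $V^\sigma(\nu^*,\mu)\le V^\sigma(\nu^*,\mu^*)\le V^\sigma(\nu,\mu^*)$ for all $(\nu,\mu)\in\mathcal P(\mathcal X)\times\mathcal P(\mathcal Y)$, and let $\mathrm{NI}(\nu,\mu)=\sup_{\mu'\in\mathcal P(\mathcal Y)}V^\sigma(\nu,\mu')-\inf_{\nu'\in\mathcal P(\mathcal X)}V^\sigma(\nu',\mu)$.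 Then $\mathrm{KL}(\nu^*|\nu_0)+\mathrm{KL}(\mu^*|\mu_0)<\infty$, and for all $t\ge0$ $$\mathrm{KL}(\nu^*|\nu_t)+\mathrm{KL}(\mu^*|\mu_t)\le e^{-\frac{\sigma^2}2t}\big(\mathrm{KL}(\nu^*|\nu_0)+\mathrm{KL}(\mu^*|\mu_0)\big),$$ $$0\le\mathrm{NI}(\nu_t,\mu_t)\le 2C_\sigma e^{-\frac{\sigma^2}4t}\sqrt{\mathrm{KL}(\nu^*|\nu_0)+\mathrm{KL}(\mu^*|\mu_0)}.$$ -/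

import Mathlib

open MeasureTheory InformationTheory Set
open scoped ENNReal

attribute [local instance] Measure.Subtype.measureSpace

noncomputable section

namespace FRGame

/-- The mixture `m + ε (m' - m) = (1 - ε) m + ε m'` of two probability measures, `ε ∈ [0,1]`. -/
def mix {M : Type*} [MeasurableSpace M] (m m' : ProbabilityMeasure M) (ε : unitInterval) :
    ProbabilityMeasure M :=
  ⟨ENNReal.ofReal (1 - (ε : ℝ)) • (m : Measure M) + ENNReal.ofReal (ε : ℝ) • (m' : Measure M), by
    constructor
    have h : ENNReal.ofReal (1 - (ε : ℝ)) + ENNReal.ofReal (ε : ℝ) = 1 := by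
      rw [← ENNReal.ofReal_add (by linarith [ε.2.2]) ε.2.1]
      simp
    simpa using h⟩

/-- `D` is the flat derivative of `G : P(M) → ℝ`, where `P(M)`, the space of all probability
measures on `M` (no moment condition), carries the topology of weak convergence. The last field
is the normalizing convention that fixes the additive constant. -/
structure IsFlatDeriv {M : Type*} [TopologicalSpace M] [MeasurableSpace M]
    [OpensMeasurableSpace M] (G : ProbabilityMeasure M → ℝ)
    (D : ProbabilityMeasure M → M → ℝ) : Prop where
  continuous : Continuous (fun q : ProbabilityMeasure M × M => D q.1 q.2)
  bounded : ∀ m : ProbabilityMeasure M, ∃ C : ℝ, ∀ x, |D m x| ≤ C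
  sub_eq : ∀ m m' : ProbabilityMeasure M, G m' - G m =
    ∫ ε : unitInterval, ((∫ x, D (mix m m' ε) x ∂(m' : Measure M)) -
      ∫ x, D (mix m m' ε) x ∂(m : Measure M))
  normalized : ∀ m : ProbabilityMeasure M, ∫ x, D m x ∂(m : Measure M) = 0

/-- An element of `P_ac(M)`: a probability density with respect to the reference measure `volume`
(for a measurable `M ⊆ ℝ^d`, Lebesgue measure on `M`). -/
structure ProbDensity (M : Type*) [MeasureSpace M] where
  toFun : M → ℝ
  measurable : Measurable toFun
  nonneg : ∀ x, 0 ≤ toFun x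
  lintegral_eq_one : ∫⁻ x, ENNReal.ofReal (toFun x) = 1

instance {M : Type*} [MeasureSpace M] : CoeFun (ProbDensity M) (fun _ => M → ℝ) :=
  ⟨ProbDensity.toFun⟩

/-- The probability measure with a given density. -/
def ProbDensity.prob {M : Type*} [MeasureSpace M] (p : ProbDensity M) : ProbabilityMeasure M :=
  ⟨volume.withDensity (fun x => ENNReal.ofReal (p x)), by
    constructor
    rw [withDensity_apply _ MeasurableSet.univ, Measure.restrict_univ]
    exact p.lintegral_eq_one⟩

/-- The relative entropy `KL(ν | π) ∈ [0, ∞]` of two probability measures. -/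
def KL {M : Type*} [MeasurableSpace M] (ν π : ProbabilityMeasure M) : ℝ≥0∞ :=
  klDiv (ν : Measure M) (π : Measure M)

/-- `π` is the reference density `π(x) ∝ exp (-U x)` of a measurable potential `U`. As `π` is a
probability density, this forces the normalizing integral to be positive and finite. -/
def IsGibbs {M : Type*} [MeasureSpace M] (U : M → ℝ) (π : ProbDensity M) : Prop :=
  Measurable U ∧ ∀ x, π x = Real.exp (-U x) / ∫ z, Real.exp (-U z)

/-- `r ≤ p(x)/π(x) ≤ R` for all `x`, with `r > 0` and `R > 1`. -/
def RatioCondition {M : Type*} [MeasureSpace M] (p π : ProbDensity M) (r R : ℝ) : Prop :=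
  0 < r ∧ 1 < R ∧ ∀ x, r ≤ p x / π x ∧ p x / π x ≤ R

section Game

variable {X Y : Type*}

section FlatDerivatives

variable [TopologicalSpace X] [MeasurableSpace X] [OpensMeasurableSpace X]
  [TopologicalSpace Y] [MeasurableSpace Y] [OpensMeasurableSpace Y]

/-- `Dν = δF/δν` and `Dμ = δF/δμ` are the first order flat derivatives of `F`. -/
def HasFlatDerivs (F : ProbabilityMeasure X → ProbabilityMeasure Y → ℝ)
    (Dν : ProbabilityMeasure X → ProbabilityMeasure Y → X → ℝ)
    (Dμ : ProbabilityMeasure X → ProbabilityMeasure Y → Y → ℝ) : Prop :=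
  (∀ μ, IsFlatDeriv (fun ν => F ν μ) (fun ν x => Dν ν μ x)) ∧
  (∀ ν, IsFlatDeriv (fun μ => F ν μ) (fun μ y => Dμ ν μ y))

/-- The first order flat derivatives are bounded by `Cν > 0` and `Cμ > 0`. -/
def BoundedFlatDerivs
    (Dν : ProbabilityMeasure X → ProbabilityMeasure Y → X → ℝ)
    (Dμ : ProbabilityMeasure X → ProbabilityMeasure Y → Y → ℝ) (Cν Cμ : ℝ) : Prop :=
  0 < Cν ∧ 0 < Cμ ∧ (∀ ν μ x, |Dν ν μ x| ≤ Cν) ∧ (∀ ν μ y, |Dμ ν μ y| ≤ Cμ)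

/-- The four second order flat derivatives `δ²F/δν²`, `δ²F/δμ²`, `δ²F/δνδμ`, `δ²F/δμδν`, i.e. the
flat derivatives of `δF/δν (ν, μ, x)` and `δF/δμ (ν, μ, y)` in `ν` and in `μ` for fixed `x`, `y`,
exist and are bounded. -/
def BoundedSecondFlatDerivs
    (Dν : ProbabilityMeasure X → ProbabilityMeasure Y → X → ℝ)
    (Dμ : ProbabilityMeasure X → ProbabilityMeasure Y → Y → ℝ) : Prop :=
  (∃ (D : ProbabilityMeasure X → ProbabilityMeasure Y → X → X → ℝ) (C : ℝ), 0 < C ∧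
    (∀ μ x, IsFlatDeriv (fun ν => Dν ν μ x) (fun ν x' => D ν μ x x')) ∧
    ∀ ν μ x x', |D ν μ x x'| ≤ C) ∧
  (∃ (D : ProbabilityMeasure X → ProbabilityMeasure Y → Y → Y → ℝ) (C : ℝ), 0 < C ∧
    (∀ ν y, IsFlatDeriv (fun μ => Dμ ν μ y) (fun μ y' => D ν μ y y')) ∧
    ∀ ν μ y y', |D ν μ y y'| ≤ C) ∧
  (∃ (D : ProbabilityMeasure X → ProbabilityMeasure Y → Y → X → ℝ) (C : ℝ), 0 < C ∧
    (∀ μ y, IsFlatDeriv (fun ν => Dμ ν μ y) (fun ν x => D ν μ y x)) ∧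
    ∀ ν μ y x, |D ν μ y x| ≤ C) ∧
  (∃ (D : ProbabilityMeasure X → ProbabilityMeasure Y → X → Y → ℝ) (C : ℝ), 0 < C ∧
    (∀ ν x, IsFlatDeriv (fun μ => Dν ν μ x) (fun μ y => D ν μ x y)) ∧
    ∀ ν μ x y, |D ν μ x y| ≤ C)

end FlatDerivatives

section Payoff

variable [MeasurableSpace X] [MeasurableSpace Y]

/-- `F` is convex in `ν` and concave in `μ`, expressed through its flat derivatives. -/
def ConvexConcave (F : ProbabilityMeasure X → ProbabilityMeasure Y → ℝ)
    (Dν : ProbabilityMeasure X → ProbabilityMeasure Y → X → ℝ)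
    (Dμ : ProbabilityMeasure X → ProbabilityMeasure Y → Y → ℝ) : Prop :=
  (∀ ν ν' μ, F ν' μ - F ν μ ≥
    (∫ x, Dν ν μ x ∂(ν' : Measure X)) - ∫ x, Dν ν μ x ∂(ν : Measure X)) ∧
  (∀ ν μ μ', F ν μ' - F ν μ ≤
    (∫ y, Dμ ν μ y ∂(μ' : Measure Y)) - ∫ y, Dμ ν μ y ∂(μ : Measure Y))

/-- The regularized payoff `V(ν, μ) = F(ν, μ) + (σ²/2) (KL(ν|π) - KL(μ|ρ))`, with values in
`[-∞, ∞]`. The value in the case `∞ - ∞` (both entropies infinite) is immaterial below: with either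
of the two possible values, the saddle point condition forces both entropies to be finite. -/
def V (σ : ℝ) (F : ProbabilityMeasure X → ProbabilityMeasure Y → ℝ)
    (π : ProbabilityMeasure X) (ρ : ProbabilityMeasure Y)
    (ν : ProbabilityMeasure X) (μ : ProbabilityMeasure Y) : EReal :=
  ((F ν μ : ℝ) : EReal) +
    ((σ ^ 2 / 2 : ℝ) : EReal) * (((KL ν π : ℝ≥0∞) : EReal) - ((KL μ ρ : ℝ≥0∞) : EReal))

/-- `(νs, μs)` is a mixed Nash equilibrium (saddle point) of `V`. -/
def IsMNE (σ : ℝ) (F : ProbabilityMeasure X → ProbabilityMeasure Y → ℝ)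
    (π : ProbabilityMeasure X) (ρ : ProbabilityMeasure Y)
    (νs : ProbabilityMeasure X) (μs : ProbabilityMeasure Y) : Prop :=
  ∀ ν μ, V σ F π ρ νs μ ≤ V σ F π ρ νs μs ∧ V σ F π ρ νs μs ≤ V σ F π ρ ν μs

/-- The Nikaidò-Isoda error `sup_{μ'} V(ν, μ') - inf_{ν'} V(ν', μ)`. -/
def NI (σ : ℝ) (F : ProbabilityMeasure X → ProbabilityMeasure Y → ℝ)
    (π : ProbabilityMeasure X) (ρ : ProbabilityMeasure Y)
    (ν : ProbabilityMeasure X) (μ : ProbabilityMeasure Y) : EReal :=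
  (⨆ μ', V σ F π ρ ν μ') - ⨅ ν', V σ F π ρ ν' μ

end Payoff

section Flow

variable [MeasureSpace X] [MeasureSpace Y]

/-- `a(ν, μ, x) = δF/δν (ν, μ, x) + (σ²/2) log (ν(x)/π(x)) - (σ²/2) KL(ν|π)`. -/
def a (σ : ℝ) (Dν : ProbabilityMeasure X → ProbabilityMeasure Y → X → ℝ) (π : ProbDensity X)
    (ν : ProbDensity X) (μ : ProbabilityMeasure Y) (x : X) : ℝ :=
  Dν ν.prob μ x + σ ^ 2 / 2 * Real.log (ν x / π x) - σ ^ 2 / 2 * (KL ν.prob π.prob).toReal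

/-- `b(ν, μ, y) = δF/δμ (ν, μ, y) - (σ²/2) log (μ(y)/ρ(y)) + (σ²/2) KL(μ|ρ)`. -/
def b (σ : ℝ) (Dμ : ProbabilityMeasure X → ProbabilityMeasure Y → Y → ℝ) (ρ : ProbDensity Y)
    (ν : ProbabilityMeasure X) (μ : ProbDensity Y) (y : Y) : ℝ :=
  Dμ ν μ.prob y - σ ^ 2 / 2 * Real.log (μ y / ρ y) + σ ^ 2 / 2 * (KL μ.prob ρ.prob).toReal

/-- `(ν_t, μ_t)_{t ≥ 0}` is a (classical) solution of the Fisher-Rao flow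
`∂_t ν_t(x) = - a(ν_t, μ_t, x) ν_t(x)`, `∂_t μ_t(y) = b(ν_t, μ_t, y) μ_t(y)` for all `x`, `y` and
`t ≥ 0` (with the one-sided derivative at `t = 0`). Values at `t < 0` play no role. Positivity of
the densities and finiteness of `KL(ν_t|π)`, `KL(μ_t|ρ)` need not be demanded: they follow for
bounded flat derivatives and an initial condition satisfying the ratio condition. -/
def IsFisherRaoFlow (σ : ℝ) (Dν : ProbabilityMeasure X → ProbabilityMeasure Y → X → ℝ)
    (Dμ : ProbabilityMeasure X → ProbabilityMeasure Y → Y → ℝ)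
    (π : ProbDensity X) (ρ : ProbDensity Y)
    (ν : ℝ → ProbDensity X) (μ : ℝ → ProbDensity Y) : Prop :=
  ∀ t : ℝ, 0 ≤ t →
    (∀ x, HasDerivWithinAt (fun s => ν s x) (-a σ Dν π (ν t) (μ t).prob x * ν t x) (Ici 0) t) ∧
    (∀ y, HasDerivWithinAt (fun s => μ s y) (b σ Dμ ρ (ν t).prob (μ t) y * μ t y) (Ici 0) t)

end Flow

end Game

end FRGame

end

/-!
The entropies are controlled through the log-ratios `log (ν_t/π)` and `log (μ_t/ρ)`, whose time
derivatives are, up to sign, the functions `a` and `b`. Each player follows an `IsEntropicPath`: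
`∂_t l = -(g + s l - s KL(p_t|q))` for the log-ratio `l` of the player's density `p_t` to the
reference density `q`, with `s = σ²/2` and `g` equal to `δF/δν` or `-δF/δμ`.

*Uniform bounds* (`IsEntropicPath.abs_logRatio_le`). The linear term `-s l` is confining. Since
`KL ≥ 0`, a barrier argument bounds `l` from below, and the spatially constant term drops out of
`l(x) - l(y)`, which is bounded by another barrier. Two probability densities always have a point
where `l ≤ 0`, which turns the bound on differences into an upper bound. Both `a` and `b` are then
bounded by a constant depending on the data only, and dominated convergence makes `∫ l_t dm`
differentiable in `t`. As `KL(m|p_t) = KL(m|q) - ∫ l_t dm` (`toReal_KL_eq_sub`), entropies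
relative to the flow are finite or infinite for all times simultaneously, and differentiable when
finite.

*Exponential decay* (`velocity_le`). For the equilibrium, the derivative of the summed entropies
`Ψ(t) = KL(νs|ν_t) + KL(μs|μ_t)` is at most `V(νs, μ_t) - V(ν_t, μs) - s Ψ(t)`, by
convexity-concavity, the normalization of the flat derivatives, and the formula for `KL(m|p_t)`.
The saddle point inequalities give `Ψ' ≤ -s Ψ`.

*The Nikaidò-Isoda error* (`NI_le`). By convexity, `V(ν_t, μ') - V(νs, μ')` is at most the integral
of a function bounded by `Cσ` against `ν_t - νs`, for any opponent `μ'` of finite entropy.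
Pinsker's inequality (`integral_sub_integral_le_sqrt_klDiv`, derived from the Donsker–Varadhan
inequality and Hoeffding's lemma) bounds it by `Cσ √(2 KL(νs|ν_t))`, and symmetrically for the other player.
-/

namespace FRGame

open Filter Topology

/-! ### Entropy inequalities for probability measures -/

section Entropy

variable {M : Type*} [MeasurableSpace M]

lemma integrable_of_abs_le {f : M → ℝ} {C : ℝ} (m : Measure M) [IsFiniteMeasure m]
    (hf : Measurable f) (hC : ∀ x, |f x| ≤ C) : Integrable f m :=
  Integrable.of_bound hf.aestronglyMeasurable C (ae_of_all _ hC)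

lemma integrable_exp_of_abs_le {f : M → ℝ} {C : ℝ} (m : Measure M) [IsFiniteMeasure m]
    (hf : Measurable f) (hC : ∀ x, |f x| ≤ C) : Integrable (fun x => Real.exp (f x)) m :=
  integrable_of_abs_le (C := Real.exp C) m hf.exp fun x => by
    rw [Real.abs_exp]
    exact Real.exp_le_exp.2 ((abs_le.1 (hC x)).2)

/-- One half of the **Donsker–Varadhan** variational formula; it expresses that the entropy of `m`
relative to the tilted measure `n.tilted f` is nonnegative. -/
lemma integral_le_klDiv_add_log_integral_exp {m n : Measure M} [IsProbabilityMeasure m]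
    [IsProbabilityMeasure n] (h : klDiv m n ≠ ⊤) {f : M → ℝ} (hfm : Integrable f m)
    (hfn : Integrable (fun x => Real.exp (f x)) n) :
    ∫ x, f x ∂m ≤ (klDiv m n).toReal + Real.log (∫ x, Real.exp (f x) ∂n) := by
  obtain ⟨hac, hint⟩ := klDiv_ne_top_iff.1 h
  have := isProbabilityMeasure_tilted hfn
  have h1 := integral_llr_add_sub_measure_univ_nonneg
    (hac.trans (absolutelyContinuous_tilted hfn)) (integrable_llr_tilted_right hac hfm hint hfn)
  rw [integral_llr_tilted_right hac hfm hfn hint] at h1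
  rw [toReal_klDiv_of_measure_eq hac (by simp)]
  simp only [probReal_univ] at h1
  linarith

/-- **Pinsker's inequality**, tested against a bounded function. -/
lemma integral_sub_integral_le_sqrt_klDiv {m n : Measure M} [IsProbabilityMeasure m]
    [IsProbabilityMeasure n] (h : klDiv m n ≠ ⊤) {f : M → ℝ} (hf : Measurable f) {C : ℝ}
    (hC : 0 < C) (hfC : ∀ x, |f x| ≤ C) :
    ∫ x, f x ∂m - ∫ x, f x ∂n ≤ C * √(2 * (klDiv m n).toReal) := by
  set Δ := ∫ x, f x ∂m - ∫ x, f x ∂n with hΔ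
  set K := (klDiv m n).toReal
  -- the optimal parameter in the exponential moment bound
  set l := Δ / C ^ 2 with hl
  have hsub := ProbabilityTheory.hasSubgaussianMGF_of_mem_Icc (μ := n) (a := -C) (b := C)
    hf.aemeasurable (ae_of_all _ fun x => abs_le.1 (hfC x))
  have hexp : ∫ x, Real.exp (l * (f x - ∫ y, f y ∂n)) ∂n ≤ Real.exp (C ^ 2 * l ^ 2 / 2) := by
    refine (hsub.mgf_le l).trans_eq ?_
    congr 2
    have : ‖C - -C‖ = 2 * C := by
      rw [Real.norm_eq_abs, abs_of_pos (by linarith)]; ring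
    push_cast
    rw [this]; ring
  have hint := hsub.integrable_exp_mul l
  have hpos : 0 < ∫ x, Real.exp (l * (f x - ∫ y, f y ∂n)) ∂n := integral_exp_pos hint
  have hfi := integrable_of_abs_le m hf hfC
  have hDV := integral_le_klDiv_add_log_integral_exp h
    ((hfi.sub (integrable_const (∫ y, f y ∂n))).const_mul l) hint
  have hlog := (Real.log_le_log hpos hexp).trans_eq (Real.log_exp _)
  simp only [Pi.sub_apply] at hDV
  rw [integral_const_mul, integral_sub hfi (integrable_const _)] at hDV
  simp only [integral_const, probReal_univ, one_smul] at hDV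
  have h2 : l * Δ - C ^ 2 * l ^ 2 / 2 ≤ K := by linarith
  have h3 : l * Δ - C ^ 2 * l ^ 2 / 2 = Δ ^ 2 / (2 * C ^ 2) := by
    rw [hl]; field_simp; ring
  rw [h3, div_le_iff₀ (by positivity)] at h2
  have h4 : Δ ≤ √(C ^ 2 * (2 * K)) := Real.le_sqrt_of_sq_le (by linarith)
  rwa [Real.sqrt_mul (by positivity), Real.sqrt_sq hC.le] at h4

end Entropy

/-! ### Densities with bounded log-ratio -/

section LogRatio

variable {M : Type*} [MeasureSpace M]

/-- The logarithm `log (p(x) / q(x))` of the ratio of two densities. It is used only for positive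
densities, so that no junk value of the division or of the logarithm occurs. -/
noncomputable def logRatio (p q : ProbDensity M) (x : M) : ℝ := Real.log (p x / q x)

lemma measurable_logRatio (p q : ProbDensity M) : Measurable (logRatio p q) :=
  (p.measurable.div q.measurable).log

lemma logRatio_swap (p q : ProbDensity M) (x : M) : logRatio q p x = -logRatio p q x := by
  rw [logRatio, logRatio, ← Real.log_inv, inv_div]

lemma coe_prob (p : ProbDensity M) :
    (p.prob : Measure M) = volume.withDensity (fun x => ENNReal.ofReal (p x)) := rfl

lemma withDensity_exp_logRatio {p q : ProbDensity M} (hp : ∀ x, 0 < p x) (hq : ∀ x, 0 < q x) :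
    (q.prob : Measure M).withDensity (fun x => ENNReal.ofReal (Real.exp (logRatio p q x))) =
      p.prob := by
  rw [coe_prob, coe_prob, ← withDensity_mul _ q.measurable.ennreal_ofReal
    (measurable_logRatio p q).exp.ennreal_ofReal]
  congr 1
  ext x
  rw [Pi.mul_apply, ← ENNReal.ofReal_mul (hq x).le, logRatio, Real.exp_log (div_pos (hp x) (hq x)),
    mul_div_cancel₀ _ (hq x).ne']

lemma integral_exp_logRatio {p q : ProbDensity M} (hp : ∀ x, 0 < p x) (hq : ∀ x, 0 < q x) :
    ∫ x, Real.exp (logRatio p q x) ∂(q.prob : Measure M) = 1 := by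
  rw [integral_eq_lintegral_of_nonneg_ae (ae_of_all _ fun x => (Real.exp_pos _).le)
    (measurable_logRatio p q).exp.aestronglyMeasurable]
  have h := congrArg (fun m : Measure M => m univ) (withDensity_exp_logRatio hp hq)
  simp only [withDensity_apply _ MeasurableSet.univ, Measure.restrict_univ, measure_univ] at h
  rw [h, ENNReal.toReal_one]

lemma tilted_logRatio {p q : ProbDensity M} (hp : ∀ x, 0 < p x) (hq : ∀ x, 0 < q x) :
    (q.prob : Measure M).tilted (logRatio p q) = p.prob := by
  rw [Measure.tilted, integral_exp_logRatio hp hq]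
  simpa using withDensity_exp_logRatio hp hq

variable {p q : ProbDensity M} {L : ℝ}

lemma KL_ne_top_of_logRatio_bounded (hp : ∀ x, 0 < p x) (hq : ∀ x, 0 < q x)
    (hL : ∀ x, |logRatio p q x| ≤ L) {m : ProbabilityMeasure M} (h : KL m q.prob ≠ ⊤) :
    KL m p.prob ≠ ⊤ := by
  obtain ⟨hac, hint⟩ := klDiv_ne_top_iff.1 h
  have he := integrable_exp_of_abs_le (q.prob : Measure M) (measurable_logRatio p q) hL
  rw [KL, ← tilted_logRatio hp hq]
  exact klDiv_ne_top (hac.trans (absolutelyContinuous_tilted he))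
    (integrable_llr_tilted_right hac
      (integrable_of_abs_le _ (measurable_logRatio p q) hL) hint he)

lemma KL_eq_top_iff (hp : ∀ x, 0 < p x) (hq : ∀ x, 0 < q x)
    (hL : ∀ x, |logRatio p q x| ≤ L) {m : ProbabilityMeasure M} :
    KL m p.prob = ⊤ ↔ KL m q.prob = ⊤ := by
  refine not_iff_not.1 ⟨KL_ne_top_of_logRatio_bounded (L := L) hq hp fun x => ?_,
    KL_ne_top_of_logRatio_bounded hp hq hL⟩
  rw [logRatio_swap, abs_neg]
  exact hL x

/-- The chain rule `log (dm/dp) = log (dm/dq) - log (p/q)`, integrated against `m`. -/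
lemma toReal_KL_eq_sub (hp : ∀ x, 0 < p x) (hq : ∀ x, 0 < q x)
    (hL : ∀ x, |logRatio p q x| ≤ L) {m : ProbabilityMeasure M} (h : KL m q.prob ≠ ⊤) :
    (KL m p.prob).toReal = (KL m q.prob).toReal - ∫ x, logRatio p q x ∂(m : Measure M) := by
  obtain ⟨hac, hint⟩ := klDiv_ne_top_iff.1 h
  have he := integrable_exp_of_abs_le (q.prob : Measure M) (measurable_logRatio p q) hL
  have hac' := hac.trans (absolutelyContinuous_tilted he)
  have hpr : IsProbabilityMeasure ((q.prob : Measure M).tilted (logRatio p q)) :=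
    isProbabilityMeasure_tilted he
  have h1 := integral_llr_tilted_right hac
    (integrable_of_abs_le (m : Measure M) (measurable_logRatio p q) hL) he hint
  rw [integral_exp_logRatio hp hq, Real.log_one, add_zero,
    ← toReal_klDiv_of_measure_eq hac' (by simp), ← toReal_klDiv_of_measure_eq hac (by simp),
    tilted_logRatio hp hq] at h1
  exact h1

lemma KL_self (m : ProbabilityMeasure M) : KL m m = 0 := klDiv_self _

lemma KL_prob_ne_top (hp : ∀ x, 0 < p x) (hq : ∀ x, 0 < q x)
    (hL : ∀ x, |logRatio p q x| ≤ L) : KL p.prob q.prob ≠ ⊤ := by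
  rw [Ne, ← KL_eq_top_iff hp hq hL, KL_self]
  exact ENNReal.zero_ne_top

lemma toReal_KL_prob (hp : ∀ x, 0 < p x) (hq : ∀ x, 0 < q x)
    (hL : ∀ x, |logRatio p q x| ≤ L) :
    (KL p.prob q.prob).toReal = ∫ x, logRatio p q x ∂(p.prob : Measure M) := by
  have h := toReal_KL_eq_sub hp hq hL (KL_prob_ne_top hp hq hL)
  rw [KL_self, ENNReal.toReal_zero] at h
  linarith

/-- Deviating from `p` to `m` lowers a linearized payoff `∫ h + s KL(· | q)` at most by a multiple
of the square root of `KL(m | p)`. Here `p` need not be optimal in any sense. -/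
lemma entropic_gap_le_sqrt (hp : ∀ x, 0 < p x) (hq : ∀ x, 0 < q x)
    (hL : ∀ x, |logRatio p q x| ≤ L) {s C B : ℝ} (hs : 0 ≤ s) (hB : 0 < B) (hCB : C + s * L ≤ B)
    {h : M → ℝ} (hm : Measurable h) (hC : ∀ x, |h x| ≤ C) {m : ProbabilityMeasure M}
    (hfin : KL m q.prob ≠ ⊤) :
    ∫ x, h x ∂(p.prob : Measure M) - ∫ x, h x ∂(m : Measure M) +
        s * ((KL p.prob q.prob).toReal - (KL m q.prob).toReal) ≤
      B * √(2 * (KL m p.prob).toReal) := by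
  have hfin' := KL_ne_top_of_logRatio_bounded hp hq hL hfin
  have hlm := measurable_logRatio p q
  have hPin := integral_sub_integral_le_sqrt_klDiv (m := (m : Measure M))
    (n := (p.prob : Measure M)) hfin' (f := fun x => -(h x + s * logRatio p q x))
    (hm.add (hlm.const_mul s)).neg hB (fun x => by
      rw [abs_neg]
      refine (abs_add_le _ _).trans (le_trans (add_le_add (hC x) ?_) hCB)
      rw [abs_mul, abs_of_nonneg hs]
      exact mul_le_mul_of_nonneg_left (hL x) hs)
  have hsplit : ∀ n : ProbabilityMeasure M,
      ∫ x, -(h x + s * logRatio p q x) ∂(n : Measure M) =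
        -(∫ x, h x ∂(n : Measure M) + s * ∫ x, logRatio p q x ∂(n : Measure M)) := fun n => by
    rw [integral_neg, integral_add (integrable_of_abs_le _ hm hC)
      ((integrable_of_abs_le _ hlm hL).const_mul s), integral_const_mul]
  rw [hsplit, hsplit] at hPin
  have h1 := toReal_KL_prob hp hq hL
  have h2 := toReal_KL_eq_sub hp hq hL hfin
  have h3 : 0 ≤ s * (KL m p.prob).toReal := mul_nonneg hs ENNReal.toReal_nonneg
  rw [h2, mul_sub] at h3
  rw [h1]
  change _ ≤ B * √(2 * (klDiv (m : Measure M) (p.prob : Measure M)).toReal)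
  linarith

lemma exists_logRatio_nonpos (hp : ∀ x, 0 < p x) (hq : ∀ x, 0 < q x) :
    ∃ x, logRatio p q x ≤ 0 := by
  by_contra! hcon
  have hlt : ∀ x, q x < p x := fun x => by
    by_contra! hle
    exact (hcon x).not_ge (Real.log_nonpos (div_pos (hp x) (hq x)).le ((div_le_one (hq x)).2 hle))
  have hv : (volume : Measure M) ≠ 0 := fun h0 => by
    have := p.lintegral_eq_one
    simp [h0] at this
  refine (lintegral_strict_mono (μ := (volume : Measure M)) hv
    p.measurable.ennreal_ofReal.aemeasurable (f := fun x => ENNReal.ofReal (q x)) ?_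
    (ae_of_all _ fun x => ?_)).ne ?_
  · rw [q.lintegral_eq_one]; exact ENNReal.one_ne_top
  · exact (ENNReal.ofReal_lt_ofReal_iff (hp x)).2 (hlt x)
  · rw [p.lintegral_eq_one, q.lintegral_eq_one]

lemma IsGibbs.pos {U : M → ℝ} (h : IsGibbs U q) (x : M) : 0 < q x := by
  refine (h.2 x).symm ▸ div_pos (Real.exp_pos _) (lt_of_le_of_ne ?_ fun h0 => ?_)
  · exact integral_nonneg fun _ => (Real.exp_pos _).le
  -- a vanishing normalizing integral would make the density `q` identically zero
  · have := q.lintegral_eq_one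
    simp [h.2, ← h0] at this

end LogRatio

/-! ### The evolution of a single density -/

/-- A path of densities `p_t` with `∂_t p_t = -(g_t + s log (p_t/q) - s KL(p_t|q)) p_t`, for a
drift `g` bounded by `C`, started at a density whose ratio to `q` lies in `[r, R]`. Both players of
the game follow such a path, with `g = δF/δν` for the first and `g = -δF/δμ` for the second. -/
structure IsEntropicPath {M : Type*} [MeasureSpace M] (s C r R : ℝ) (q : ProbDensity M)
    (g : ℝ → M → ℝ) (p : ℝ → ProbDensity M) : Prop where
  s_pos : 0 < s
  C_nonneg : 0 ≤ C
  ref_pos : ∀ x, 0 < q x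
  ratio : RatioCondition (p 0) q r R
  drift_le : ∀ t, 0 ≤ t → ∀ x, |g t x| ≤ C
  flow : ∀ t, 0 ≤ t → ∀ x, HasDerivWithinAt (fun τ => p τ x)
    (-(g t x + s * logRatio (p t) q x - s * (KL (p t).prob q.prob).toReal) * p t x) (Ici 0) t

/-- A bound for `|log (p_t/q)|` along an entropic path, uniform in time and space. -/
noncomputable def logRatioBound (s C r R : ℝ) : ℝ := |Real.log r| + |Real.log R| + (2 * C + 1) / s

namespace IsEntropicPath

variable {M : Type*} [MeasureSpace M] {s C r R : ℝ} {q : ProbDensity M} {g : ℝ → M → ℝ}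
  {p : ℝ → ProbDensity M}

/-- A lower barrier. Where `log (p_t/q)` is below `-C/s`, the ratio `p_t/q` increases, because
the spatially constant term `KL(p_t|q)` has the favourable sign; no regularity of this term in
time is needed, and the sign persists for the junk value `0` that `toReal` takes should the entropy
be infinite. The summand `1 / s` makes the derivative strictly positive at the barrier. -/
lemma exp_le_ratio (h : IsEntropicPath s C r R q g p) {t : ℝ} (ht : 0 ≤ t) (x : M) :
    Real.exp (-(|Real.log r| + (C + 1) / s)) ≤ p t x / q x := by
  obtain ⟨hr, -, hrat⟩ := h.ratio
  have hs := h.s_pos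
  set K := |Real.log r| + (C + 1) / s with hK
  have hd : ∀ τ, 0 ≤ τ → HasDerivWithinAt (fun τ => -(p τ x / q x))
      (-(-(g τ x + s * logRatio (p τ) q x - s * (KL (p τ).prob q.prob).toReal) * p τ x / q x))
      (Ici 0) τ := fun τ hτ => ((h.flow τ hτ x).div_const (q x)).neg
  have := image_le_of_deriv_right_lt_deriv_boundary (a := 0) (b := t)
    (f := fun τ => -(p τ x / q x))
    (B := fun _ => -Real.exp (-K)) (B' := fun _ => 0)
    (fun τ hτ => ((hd τ hτ.1).continuousWithinAt).mono fun y hy => hy.1)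
    (fun τ hτ => (hd τ hτ.1).mono (Ici_subset_Ici.2 hτ.1)) ?_ (fun τ => hasDerivAt_const _ _) ?_
    (right_mem_Icc.2 ht)
  · exact neg_le_neg_iff.1 this
  · refine neg_le_neg (le_trans ?_ (hrat x).1)
    rw [← Real.le_log_iff_exp_le hr]
    have h1 := neg_abs_le (Real.log r)
    have h2 : 0 ≤ (C + 1) / s := div_nonneg (by linarith [h.C_nonneg]) hs.le
    linarith
  · intro τ hτ heq
    have heq' : p τ x / q x = Real.exp (-K) := neg_injective heq
    have hlog : logRatio (p τ) q x = -K := by rw [logRatio, heq', Real.log_exp]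
    rw [mul_div_assoc, heq', hlog, neg_mul, neg_neg]
    refine mul_neg_of_neg_of_pos ?_ (Real.exp_pos _)
    have h1 := (abs_le.1 (h.drift_le τ hτ.1 x)).2
    have h2 : s * K = s * |Real.log r| + (C + 1) := by rw [hK]; field_simp
    have h3 : 0 ≤ s * |Real.log r| := by positivity
    have h4 : 0 ≤ s * (KL (p τ).prob q.prob).toReal := mul_nonneg hs.le ENNReal.toReal_nonneg
    linarith

lemma pos (h : IsEntropicPath s C r R q g p) {t : ℝ} (ht : 0 ≤ t) (x : M) : 0 < p t x := by
  have h1 := (Real.exp_pos _).trans_le (h.exp_le_ratio ht x)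
  exact (div_pos_iff_of_pos_right (h.ref_pos x)).1 h1

lemma hasDerivWithinAt_logRatio (h : IsEntropicPath s C r R q g p) {t : ℝ} (ht : 0 ≤ t) (x : M) :
    HasDerivWithinAt (fun τ => logRatio (p τ) q x)
      (-(g t x + s * logRatio (p t) q x - s * (KL (p t).prob q.prob).toReal)) (Ici 0) t := by
  have hp := h.pos ht x
  have hq := h.ref_pos x
  convert! ((h.flow t ht x).div_const (q x)).log (div_pos hp hq).ne' using 1
  field_simp

/-- The spatially constant term cancels in the difference of the log-ratios at two points. -/
lemma logRatio_sub_le (h : IsEntropicPath s C r R q g p) {t : ℝ} (ht : 0 ≤ t) (x y : M) :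
    logRatio (p t) q x - logRatio (p t) q y ≤ logRatioBound s C r R := by
  obtain ⟨hr, hR, hrat⟩ := h.ratio
  have hs := h.s_pos
  have hC := h.C_nonneg
  have hd : ∀ τ, 0 ≤ τ → HasDerivWithinAt (fun τ => logRatio (p τ) q x - logRatio (p τ) q y) _
      (Ici 0) τ := fun τ hτ =>
    (h.hasDerivWithinAt_logRatio hτ x).sub (h.hasDerivWithinAt_logRatio hτ y)
  refine image_le_of_deriv_right_lt_deriv_boundary (a := 0) (b := t)
    (f := fun τ => logRatio (p τ) q x - logRatio (p τ) q y)
    (B := fun _ => logRatioBound s C r R) (B' := fun _ => 0)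
    (fun τ hτ => ((hd τ hτ.1).continuousWithinAt).mono fun y hy => hy.1)
    (fun τ hτ => (hd τ hτ.1).mono (Ici_subset_Ici.2 hτ.1)) ?_ (fun τ => hasDerivAt_const _ _) ?_
    (right_mem_Icc.2 ht)
  · have h1 : logRatio (p 0) q x ≤ Real.log R :=
      Real.log_le_log (hr.trans_le (hrat x).1) (hrat x).2
    have h2 : Real.log r ≤ logRatio (p 0) q y := Real.log_le_log hr (hrat y).1
    have h3 := neg_abs_le (Real.log r)
    have h4 := le_abs_self (Real.log R)
    have h5 : 0 ≤ (2 * C + 1) / s := by positivity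
    simp only [logRatioBound]
    linarith
  · intro τ hτ heq
    have h1 := (abs_le.1 (h.drift_le τ hτ.1 x)).1
    have h2 := (abs_le.1 (h.drift_le τ hτ.1 y)).2
    have h3 : s * (logRatio (p τ) q x - logRatio (p τ) q y) =
        s * (|Real.log r| + |Real.log R|) + (2 * C + 1) := by
      rw [heq, logRatioBound]; field_simp
    have h4 : 0 ≤ s * (|Real.log r| + |Real.log R|) := by positivity
    linarith

/-- The lower barrier, and an upper bound obtained by comparing with a point where `p_t ≤ q`;
such a point exists because both densities have mass one. -/
lemma abs_logRatio_le (h : IsEntropicPath s C r R q g p) {t : ℝ} (ht : 0 ≤ t) (x : M) :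
    |logRatio (p t) q x| ≤ logRatioBound s C r R := by
  refine abs_le.2 ⟨?_, ?_⟩
  · have h1 := Real.log_le_log (Real.exp_pos _) (h.exp_le_ratio ht x)
    rw [Real.log_exp] at h1
    have h2 : (C + 1) / s ≤ (2 * C + 1) / s :=
      div_le_div_of_nonneg_right (by linarith [h.C_nonneg]) h.s_pos.le
    have h3 := abs_nonneg (Real.log R)
    simp only [logRatioBound]
    change _ ≤ Real.log _
    linarith
  · obtain ⟨y, hy⟩ := exists_logRatio_nonpos (h.pos ht) h.ref_pos
    linarith [h.logRatio_sub_le ht x y]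

lemma KL_ref_ne_top (h : IsEntropicPath s C r R q g p) {t : ℝ} (ht : 0 ≤ t) :
    KL (p t).prob q.prob ≠ ⊤ :=
  KL_prob_ne_top (h.pos ht) h.ref_pos (h.abs_logRatio_le ht)

lemma KL_eq_top_iff (h : IsEntropicPath s C r R q g p) {t : ℝ} (ht : 0 ≤ t)
    {m : ProbabilityMeasure M} : KL m (p t).prob = ⊤ ↔ KL m q.prob = ⊤ :=
  FRGame.KL_eq_top_iff (h.pos ht) h.ref_pos (h.abs_logRatio_le ht)

lemma toReal_KL_eq (h : IsEntropicPath s C r R q g p) {t : ℝ} (ht : 0 ≤ t)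
    {m : ProbabilityMeasure M} (hm : KL m q.prob ≠ ⊤) :
    (KL m (p t).prob).toReal =
      (KL m q.prob).toReal - ∫ x, logRatio (p t) q x ∂(m : Measure M) :=
  toReal_KL_eq_sub (h.pos ht) h.ref_pos (h.abs_logRatio_le ht) hm

/-- The bound does not refer to the drift of the path: `c` may be the value of the flat derivative
at any argument. -/
lemma abs_add_le (h : IsEntropicPath s C r R q g p) {t : ℝ} (ht : 0 ≤ t) (x : M) {c : ℝ}
    (hc : |c| ≤ C) :
    |c + s * logRatio (p t) q x - s * (KL (p t).prob q.prob).toReal| ≤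
      C + 2 * s * logRatioBound s C r R := by
  have hl := abs_le.1 (h.abs_logRatio_le ht x)
  have hc' := abs_le.1 hc
  have hK : |(KL (p t).prob q.prob).toReal| ≤ logRatioBound s C r R := by
    rw [toReal_KL_prob (h.pos ht) h.ref_pos (h.abs_logRatio_le ht)]
    rw [← Real.norm_eq_abs]
    refine (norm_integral_le_of_norm_le_const (C := logRatioBound s C r R)
      (ae_of_all ((p t).prob : Measure M) fun x => h.abs_logRatio_le ht x)).trans_eq ?_
    simp
  have hK' := abs_le.1 hK
  have hs := h.s_pos.le
  have e1 := mul_le_mul_of_nonneg_left hl.1 hs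
  have e2 := mul_le_mul_of_nonneg_left hl.2 hs
  have e3 := mul_le_mul_of_nonneg_left hK'.1 hs
  have e4 := mul_le_mul_of_nonneg_left hK'.2 hs
  exact abs_le.2 ⟨by linarith, by linarith⟩

/-- Differentiation under the integral sign. Dominated convergence of the difference quotients
applies, as they are bounded by the supremum of the time derivative; only the pointwise derivative
exists, and nothing is assumed on its dependence on time. -/
lemma hasDerivWithinAt_integral_logRatio (h : IsEntropicPath s C r R q g p) {t : ℝ} (ht : 0 ≤ t)
    (m : ProbabilityMeasure M) :
    HasDerivWithinAt (fun τ => ∫ x, logRatio (p τ) q x ∂(m : Measure M))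
      (∫ x, -(g t x + s * logRatio (p t) q x - s * (KL (p t).prob q.prob).toReal)
        ∂(m : Measure M)) (Ici 0) t := by
  rw [hasDerivWithinAt_iff_tendsto_slope]
  have hmem : ∀ᶠ τ in 𝓝[Ici 0 \ {t}] t, τ ∈ Ici (0 : ℝ) :=
    eventually_nhdsWithin_of_forall fun τ hτ => hτ.1
  have hlim := tendsto_integral_filter_of_dominated_convergence (μ := (m : Measure M))
    (l := 𝓝[Ici 0 \ {t}] t) (F := fun τ x => slope (fun τ => logRatio (p τ) q x) t τ)
    (f := fun x => -(g t x + s * logRatio (p t) q x - s * (KL (p t).prob q.prob).toReal))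
    (fun _ => C + 2 * s * logRatioBound s C r R)
    (Eventually.of_forall fun τ => by
      simp only [slope_def_field]
      exact (((measurable_logRatio _ _).sub (measurable_logRatio _ _)).div_const _
        ).aestronglyMeasurable)
    (by
      filter_upwards [eventually_mem_nhdsWithin] with τ hτ
      refine ae_of_all _ fun x => ?_
      have h1 := Convex.norm_image_sub_le_of_norm_hasDerivWithin_le
        (fun u (hu : u ∈ Ici (0 : ℝ)) => h.hasDerivWithinAt_logRatio hu x)
        (fun u hu => by
          rw [norm_neg]
          exact h.abs_add_le hu x (h.drift_le u hu x)) (convex_Ici 0) (mem_Ici.2 ht) hτ.1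
      have h2 : 0 < ‖τ - t‖ := norm_pos_iff.2 (sub_ne_zero.2 hτ.2)
      rw [slope_def_field, norm_div, div_le_iff₀ h2]
      exact h1)
    (integrable_const _)
    (ae_of_all _ fun x => hasDerivWithinAt_iff_tendsto_slope.1 (h.hasDerivWithinAt_logRatio ht x))
  refine hlim.congr' ?_
  filter_upwards [hmem] with τ hτ
  simp only [slope_def_field]
  rw [integral_div, integral_sub
    (integrable_of_abs_le _ (measurable_logRatio _ _) (h.abs_logRatio_le hτ))
    (integrable_of_abs_le _ (measurable_logRatio _ _) (h.abs_logRatio_le ht))]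

lemma hasDerivWithinAt_toReal_KL (h : IsEntropicPath s C r R q g p) {t : ℝ} (ht : 0 ≤ t)
    {m : ProbabilityMeasure M} (hm : KL m q.prob ≠ ⊤) :
    HasDerivWithinAt (fun τ => (KL m (p τ).prob).toReal)
      (∫ x, (g t x + s * logRatio (p t) q x - s * (KL (p t).prob q.prob).toReal)
        ∂(m : Measure M)) (Ici 0) t := by
  have h1 := (h.hasDerivWithinAt_integral_logRatio ht m).const_sub (KL m q.prob).toReal
  rw [integral_neg, neg_neg] at h1
  exact h1.congr (fun τ hτ => h.toReal_KL_eq hτ hm) (h.toReal_KL_eq ht hm)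

/-- The entropy dissipation identity behind the exponential rate: the term
`-s KL(m | p_t)` comes from the entropic part of the velocity. -/
lemma integral_velocity_eq (h : IsEntropicPath s C r R q g p) {t : ℝ} (ht : 0 ≤ t)
    (hg : Measurable (g t)) {m : ProbabilityMeasure M} (hm : KL m q.prob ≠ ⊤) :
    ∫ x, (g t x + s * logRatio (p t) q x - s * (KL (p t).prob q.prob).toReal) ∂(m : Measure M) =
      ∫ x, g t x ∂(m : Measure M) + s * (KL m q.prob).toReal
        - s * (KL (p t).prob q.prob).toReal - s * (KL m (p t).prob).toReal := by
  have hgi := integrable_of_abs_le (m : Measure M) hg (h.drift_le t ht)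
  have hli := (integrable_of_abs_le (m : Measure M) (measurable_logRatio (p t) q)
    (h.abs_logRatio_le ht)).const_mul s
  rw [integral_sub (f := fun x => g t x + s * logRatio (p t) q x) (hgi.add hli)
    (integrable_const _), integral_add hgi hli, integral_const_mul, h.toReal_KL_eq ht hm]
  simp only [integral_const, probReal_univ, one_smul]
  ring

end IsEntropicPath

/-! ### Finite values of the regularized payoff -/

section Payoff

variable {X Y : Type*} [MeasurableSpace X] [MeasurableSpace Y] {σ : ℝ}
  {F : ProbabilityMeasure X → ProbabilityMeasure Y → ℝ}
  {π ν νs : ProbabilityMeasure X} {ρ μ μs : ProbabilityMeasure Y}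

lemma V_eq_coe (hν : KL ν π ≠ ⊤) (hμ : KL μ ρ ≠ ⊤) :
    V σ F π ρ ν μ =
      ((F ν μ + σ ^ 2 / 2 * ((KL ν π).toReal - (KL μ ρ).toReal) : ℝ) : EReal) := by
  rw [V, ← EReal.coe_ennreal_toReal hν, ← EReal.coe_ennreal_toReal hμ]
  norm_cast

lemma V_eq_bot (hσ : 0 < σ) (hν : KL ν π ≠ ⊤) (hμ : KL μ ρ = ⊤) : V σ F π ρ ν μ = ⊥ := by
  rw [V, ← EReal.coe_ennreal_toReal hν, hμ, EReal.coe_ennreal_top, EReal.sub_top,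
    EReal.coe_mul_bot_of_pos (by positivity), EReal.add_bot]

lemma V_eq_top (hσ : 0 < σ) (hν : KL ν π = ⊤) (hμ : KL μ ρ ≠ ⊤) : V σ F π ρ ν μ = ⊤ := by
  rw [V, ← EReal.coe_ennreal_toReal hμ, hν, EReal.coe_ennreal_top, EReal.top_sub_coe,
    EReal.coe_mul_top_of_pos (by positivity), EReal.coe_add_top]

/-- Comparing the two deviations `V(νs, ρ) ≤ V(π, μs)` shows that a saddle point has finite
entropies, whatever value is given to `∞ - ∞`. -/
lemma IsMNE.KL_ne_top (hσ : 0 < σ) (h : IsMNE σ F π ρ νs μs) :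
    KL νs π ≠ ⊤ ∧ KL μs ρ ≠ ⊤ := by
  have hle : V σ F π ρ νs ρ ≤ V σ F π ρ π μs := (h π ρ).1.trans (h π ρ).2
  have hπ : KL π π ≠ ⊤ := by simp [KL, klDiv_self]
  have hρ : KL ρ ρ ≠ ⊤ := by simp [KL, klDiv_self]
  constructor
  · intro htop
    rw [V_eq_top hσ htop hρ, top_le_iff] at hle
    by_cases hμ : KL μs ρ = ⊤
    · rw [V_eq_bot hσ hπ hμ] at hle
      exact bot_ne_top hle
    · rw [V_eq_coe hπ hμ] at hle
      exact EReal.coe_ne_top _ hle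
  · intro htop
    rw [V_eq_bot hσ hπ htop, le_bot_iff] at hle
    by_cases hν : KL νs π = ⊤
    · rw [V_eq_top hσ hν hρ] at hle
      exact bot_ne_top hle.symm
    · rw [V_eq_coe hν hρ] at hle
      exact EReal.coe_ne_bot _ hle

lemma IsMNE.le_first (hσ : 0 < σ) (h : IsMNE σ F π ρ νs μs) (hν : KL ν π ≠ ⊤) :
    F νs μs + σ ^ 2 / 2 * ((KL νs π).toReal - (KL μs ρ).toReal) ≤
      F ν μs + σ ^ 2 / 2 * ((KL ν π).toReal - (KL μs ρ).toReal) := by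
  obtain ⟨h1, h2⟩ := h.KL_ne_top hσ
  have := (h ν ρ).2
  rwa [V_eq_coe h1 h2, V_eq_coe hν h2, EReal.coe_le_coe_iff] at this

lemma IsMNE.second_le (hσ : 0 < σ) (h : IsMNE σ F π ρ νs μs) (hμ : KL μ ρ ≠ ⊤) :
    F νs μ + σ ^ 2 / 2 * ((KL νs π).toReal - (KL μ ρ).toReal) ≤
      F νs μs + σ ^ 2 / 2 * ((KL νs π).toReal - (KL μs ρ).toReal) := by
  obtain ⟨h1, h2⟩ := h.KL_ne_top hσ
  have := (h π μ).1
  rwa [V_eq_coe h1 h2, V_eq_coe h1 hμ, EReal.coe_le_coe_iff] at this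

lemma NI_nonneg (hν : KL ν π ≠ ⊤) (hμ : KL μ ρ ≠ ⊤) : 0 ≤ NI σ F π ρ ν μ := by
  have h := EReal.sub_le_sub (le_iSup (fun μ' => V σ F π ρ ν μ') μ)
    (iInf_le (fun ν' => V σ F π ρ ν' μ) ν)
  refine le_trans ?_ h
  rw [V_eq_coe hν hμ]
  norm_cast
  simp

end Payoff

/-! ### The coupled flow -/

section Coupled

variable {X Y : Type*} [MeasureSpace X] [MeasureSpace Y] {σ Cν Cμ rν rμ Rν Rμ : ℝ}
  {π : ProbDensity X} {ρ : ProbDensity Y}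
  {F : ProbabilityMeasure X → ProbabilityMeasure Y → ℝ}
  {Dν : ProbabilityMeasure X → ProbabilityMeasure Y → X → ℝ}
  {Dμ : ProbabilityMeasure X → ProbabilityMeasure Y → Y → ℝ}
  {ν : ℝ → ProbDensity X} {μ : ℝ → ProbDensity Y}

lemma IsFisherRaoFlow.isEntropicPath_first (hσ : 0 < σ)
    (hflow : IsFisherRaoFlow σ Dν Dμ π ρ ν μ) (hπ : ∀ x, 0 < π x)
    (hD : BoundedFlatDerivs Dν Dμ Cν Cμ) (hrat : RatioCondition (ν 0) π rν Rν) :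
    IsEntropicPath (σ ^ 2 / 2) Cν rν Rν π (fun t x => Dν (ν t).prob (μ t).prob x) ν where
  s_pos := by positivity
  C_nonneg := hD.1.le
  ref_pos := hπ
  ratio := hrat
  drift_le _ _ x := hD.2.2.1 _ _ x
  flow t ht x := (hflow t ht).1 x

lemma IsFisherRaoFlow.isEntropicPath_second (hσ : 0 < σ)
    (hflow : IsFisherRaoFlow σ Dν Dμ π ρ ν μ) (hρ : ∀ y, 0 < ρ y)
    (hD : BoundedFlatDerivs Dν Dμ Cν Cμ) (hrat : RatioCondition (μ 0) ρ rμ Rμ) :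
    IsEntropicPath (σ ^ 2 / 2) Cμ rμ Rμ ρ (fun t y => -Dμ (ν t).prob (μ t).prob y) μ where
  s_pos := by positivity
  C_nonneg := hD.2.1.le
  ref_pos := hρ
  ratio := hrat
  drift_le _ _ y := by
    rw [abs_neg]
    exact hD.2.2.2 _ _ y
  flow t ht y := by
    convert! (hflow t ht).2 y using 1
    simp only [b, logRatio]
    ring

/-- Finiteness of the summed entropies amounts to finiteness relative to the reference densities;
in particular, it does not depend on time. -/
lemma KL_add_KL_eq_top_iff {s : ℝ} {g : ℝ → X → ℝ} {g' : ℝ → Y → ℝ}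
    (hν : IsEntropicPath s Cν rν Rν π g ν) (hμ : IsEntropicPath s Cμ rμ Rμ ρ g' μ)
    {t : ℝ} (ht : 0 ≤ t) {m : ProbabilityMeasure X} {n : ProbabilityMeasure Y} :
    KL m (ν t).prob + KL n (μ t).prob = ⊤ ↔ KL m π.prob = ⊤ ∨ KL n ρ.prob = ⊤ := by
  rw [ENNReal.add_eq_top, hν.KL_eq_top_iff ht, hμ.KL_eq_top_iff ht]

lemma toReal_KL_add_KL {s : ℝ} {g : ℝ → X → ℝ} {g' : ℝ → Y → ℝ}
    (hν : IsEntropicPath s Cν rν Rν π g ν) (hμ : IsEntropicPath s Cμ rμ Rμ ρ g' μ)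
    {t : ℝ} (ht : 0 ≤ t) {m : ProbabilityMeasure X} {n : ProbabilityMeasure Y}
    (hm : KL m π.prob ≠ ⊤) (hn : KL n ρ.prob ≠ ⊤) :
    (KL m (ν t).prob + KL n (μ t).prob).toReal =
      (KL m (ν t).prob).toReal + (KL n (μ t).prob).toReal :=
  ENNReal.toReal_add (mt (hν.KL_eq_top_iff ht).1 hm) (mt (hμ.KL_eq_top_iff ht).1 hn)

lemma hasDerivWithinAt_toReal_KL_add_KL {s : ℝ} {g : ℝ → X → ℝ} {g' : ℝ → Y → ℝ}
    (hν : IsEntropicPath s Cν rν Rν π g ν) (hμ : IsEntropicPath s Cμ rμ Rμ ρ g' μ)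
    {t : ℝ} (ht : 0 ≤ t) {m : ProbabilityMeasure X} {n : ProbabilityMeasure Y}
    (hm : KL m π.prob ≠ ⊤) (hn : KL n ρ.prob ≠ ⊤) :
    HasDerivWithinAt (fun τ => (KL m (ν τ).prob + KL n (μ τ).prob).toReal)
      (∫ x, (g t x + s * logRatio (ν t) π x - s * (KL (ν t).prob π.prob).toReal) ∂(m : Measure X) +
        ∫ y, (g' t y + s * logRatio (μ t) ρ y - s * (KL (μ t).prob ρ.prob).toReal)
          ∂(n : Measure Y)) (Ici 0) t :=
  ((hν.hasDerivWithinAt_toReal_KL ht hm).add (hμ.hasDerivWithinAt_toReal_KL ht hn)).congr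
    (fun _ hτ => toReal_KL_add_KL hν hμ hτ hm hn) (toReal_KL_add_KL hν hμ ht hm hn)

/-- A quantity with `f' ≤ -s f` decays at rate `s`. -/
lemma le_exp_mul_of_deriv_le {s : ℝ} {f f' : ℝ → ℝ}
    (hf : ∀ t, 0 ≤ t → HasDerivWithinAt f (f' t) (Ici 0) t)
    (hle : ∀ t, 0 ≤ t → f' t ≤ -(s * f t)) {t : ℝ} (ht : 0 ≤ t) :
    f t ≤ Real.exp (-(s * t)) * f 0 := by
  have hd : ∀ τ, 0 ≤ τ → HasDerivWithinAt (fun τ => Real.exp (s * τ) * f τ)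
      (Real.exp (s * τ) * (s * 1) * f τ + Real.exp (s * τ) * f' τ) (Ici 0) τ := fun τ hτ =>
    (((hasDerivAt_id τ).const_mul s).exp.hasDerivWithinAt).mul (hf τ hτ)
  have hanti : AntitoneOn (fun τ => Real.exp (s * τ) * f τ) (Ici 0) := by
    refine antitoneOn_of_hasDerivWithinAt_nonpos (convex_Ici 0)
      (f' := fun τ => Real.exp (s * τ) * (s * 1) * f τ + Real.exp (s * τ) * f' τ)
      (fun τ hτ => (hd τ hτ).continuousWithinAt)
      (fun τ hτ => (hd τ (interior_subset hτ)).mono interior_subset) fun τ hτ => ?_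
    have h1 := mul_le_mul_of_nonneg_left (hle τ (interior_subset hτ)) (Real.exp_pos (s * τ)).le
    linarith
  have h := hanti (mem_Ici.2 le_rfl) (mem_Ici.2 ht) ht
  simp only [mul_zero, Real.exp_zero, one_mul] at h
  calc f t = Real.exp (-(s * t)) * (Real.exp (s * t) * f t) := by
        rw [← mul_assoc, ← Real.exp_add, neg_add_cancel, Real.exp_zero, one_mul]
    _ ≤ _ := mul_le_mul_of_nonneg_left h (Real.exp_pos _).le

variable [TopologicalSpace X] [OpensMeasurableSpace X]
  [TopologicalSpace Y] [OpensMeasurableSpace Y]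

lemma IsFlatDeriv.measurable {G : ProbabilityMeasure X → ℝ} {D : ProbabilityMeasure X → X → ℝ}
    (h : IsFlatDeriv G D) (m : ProbabilityMeasure X) : Measurable (D m) :=
  (h.continuous.comp (Continuous.prodMk_right m)).measurable

/-- Convexity-concavity turns the first order terms of the velocity into `V(νs, μ_t) - V(ν_t, μs)`,
which is nonpositive at an equilibrium; what remains is the entropy itself. -/
lemma velocity_le (hσ : 0 < σ) (hF : HasFlatDerivs F Dν Dμ) (hcc : ConvexConcave F Dν Dμ)
    (hν : IsEntropicPath (σ ^ 2 / 2) Cν rν Rν π (fun t x => Dν (ν t).prob (μ t).prob x) ν)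
    (hμ : IsEntropicPath (σ ^ 2 / 2) Cμ rμ Rμ ρ (fun t y => -Dμ (ν t).prob (μ t).prob y) μ)
    {νs : ProbabilityMeasure X} {μs : ProbabilityMeasure Y}
    (h : IsMNE σ F π.prob ρ.prob νs μs) {t : ℝ} (ht : 0 ≤ t) :
    ∫ x, (Dν (ν t).prob (μ t).prob x + σ ^ 2 / 2 * logRatio (ν t) π x
          - σ ^ 2 / 2 * (KL (ν t).prob π.prob).toReal) ∂(νs : Measure X) +
        ∫ y, (-Dμ (ν t).prob (μ t).prob y + σ ^ 2 / 2 * logRatio (μ t) ρ y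
          - σ ^ 2 / 2 * (KL (μ t).prob ρ.prob).toReal) ∂(μs : Measure Y) ≤
      -(σ ^ 2 / 2 * (KL νs (ν t).prob + KL μs (μ t).prob).toReal) := by
  obtain ⟨h1, h2⟩ := h.KL_ne_top hσ
  rw [hν.integral_velocity_eq ht ((hF.1 _).measurable _) h1,
    hμ.integral_velocity_eq ht ((hF.2 _).measurable _).neg h2, integral_neg,
    toReal_KL_add_KL hν hμ ht h1 h2]
  have e1 := hcc.1 (ν t).prob νs (μ t).prob
  have e2 := hcc.2 (ν t).prob (μ t).prob μs
  have e3 := (hF.1 (μ t).prob).normalized (ν t).prob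
  have e4 := (hF.2 (ν t).prob).normalized (μ t).prob
  have e5 := h.le_first hσ (hν.KL_ref_ne_top ht)
  have e6 := h.second_le hσ (hμ.KL_ref_ne_top ht)
  rw [e3] at e1
  rw [e4] at e2
  linarith

/-- Replacing `ν_t` by `νs` against an arbitrary opponent lowers the payoff by at most
`B √(2 KL(νs | ν_t))`, so the best response value against `ν_t` is close to the equilibrium
value. -/
lemma V_first_le (hσ : 0 < σ) (hF : HasFlatDerivs F Dν Dμ) (hcc : ConvexConcave F Dν Dμ)
    (hD : BoundedFlatDerivs Dν Dμ Cν Cμ) {g : ℝ → X → ℝ}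
    (hν : IsEntropicPath (σ ^ 2 / 2) Cν rν Rν π g ν)
    {νs : ProbabilityMeasure X} {μs : ProbabilityMeasure Y}
    (h : IsMNE σ F π.prob ρ.prob νs μs) {t : ℝ} (ht : 0 ≤ t) {B : ℝ} (hB : 0 < B)
    (hCB : Cν + σ ^ 2 / 2 * logRatioBound (σ ^ 2 / 2) Cν rν Rν ≤ B)
    (μ' : ProbabilityMeasure Y) :
    V σ F π.prob ρ.prob (ν t).prob μ' ≤
      ((F νs μs + σ ^ 2 / 2 * ((KL νs π.prob).toReal - (KL μs ρ.prob).toReal) +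
        B * √(2 * (KL νs (ν t).prob).toReal) : ℝ) : EReal) := by
  obtain ⟨h1, -⟩ := h.KL_ne_top hσ
  by_cases hμ' : KL μ' ρ.prob = ⊤
  · rw [V_eq_bot hσ (hν.KL_ref_ne_top ht) hμ']
    exact bot_le
  rw [V_eq_coe (hν.KL_ref_ne_top ht) hμ', EReal.coe_le_coe_iff]
  have e1 := entropic_gap_le_sqrt (hν.pos ht) hν.ref_pos (hν.abs_logRatio_le ht) hν.s_pos.le
    hB hCB ((hF.1 μ').measurable (ν t).prob) (hD.2.2.1 _ _) h1
  have e2 := hcc.1 (ν t).prob νs μ'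
  have e3 := h.second_le hσ hμ'
  linarith

lemma le_V_second (hσ : 0 < σ) (hF : HasFlatDerivs F Dν Dμ) (hcc : ConvexConcave F Dν Dμ)
    (hD : BoundedFlatDerivs Dν Dμ Cν Cμ) {g : ℝ → Y → ℝ}
    (hμ : IsEntropicPath (σ ^ 2 / 2) Cμ rμ Rμ ρ g μ)
    {νs : ProbabilityMeasure X} {μs : ProbabilityMeasure Y}
    (h : IsMNE σ F π.prob ρ.prob νs μs) {t : ℝ} (ht : 0 ≤ t) {B : ℝ} (hB : 0 < B)
    (hCB : Cμ + σ ^ 2 / 2 * logRatioBound (σ ^ 2 / 2) Cμ rμ Rμ ≤ B)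
    (ν' : ProbabilityMeasure X) :
    ((F νs μs + σ ^ 2 / 2 * ((KL νs π.prob).toReal - (KL μs ρ.prob).toReal) -
        B * √(2 * (KL μs (μ t).prob).toReal) : ℝ) : EReal) ≤
      V σ F π.prob ρ.prob ν' (μ t).prob := by
  obtain ⟨-, h2⟩ := h.KL_ne_top hσ
  by_cases hν' : KL ν' π.prob = ⊤
  · rw [V_eq_top hσ hν' (hμ.KL_ref_ne_top ht)]
    exact le_top
  rw [V_eq_coe hν' (hμ.KL_ref_ne_top ht), EReal.coe_le_coe_iff]
  have e1 := entropic_gap_le_sqrt (hμ.pos ht) hμ.ref_pos (hμ.abs_logRatio_le ht) hμ.s_pos.le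
    hB hCB ((hF.2 ν').measurable (μ t).prob).neg
    (fun y => (abs_neg (Dμ ν' (μ t).prob y)).trans_le (hD.2.2.2 _ _ y)) h2
  simp only [Pi.neg_apply, integral_neg] at e1
  have e2 := hcc.2 ν' (μ t).prob μs
  have e3 := h.le_first hσ hν'
  linarith

lemma NI_le (hσ : 0 < σ) (hF : HasFlatDerivs F Dν Dμ) (hcc : ConvexConcave F Dν Dμ)
    (hD : BoundedFlatDerivs Dν Dμ Cν Cμ) {g : ℝ → X → ℝ} {g' : ℝ → Y → ℝ}
    (hν : IsEntropicPath (σ ^ 2 / 2) Cν rν Rν π g ν)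
    (hμ : IsEntropicPath (σ ^ 2 / 2) Cμ rμ Rμ ρ g' μ)
    {νs : ProbabilityMeasure X} {μs : ProbabilityMeasure Y}
    (h : IsMNE σ F π.prob ρ.prob νs μs) {t : ℝ} (ht : 0 ≤ t) {B : ℝ} (hB : 0 < B)
    (hCBν : Cν + σ ^ 2 / 2 * logRatioBound (σ ^ 2 / 2) Cν rν Rν ≤ B)
    (hCBμ : Cμ + σ ^ 2 / 2 * logRatioBound (σ ^ 2 / 2) Cμ rμ Rμ ≤ B) :
    NI σ F π.prob ρ.prob (ν t).prob (μ t).prob ≤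
      ((2 * B * √((KL νs (ν t).prob + KL μs (μ t).prob).toReal) : ℝ) : EReal) := by
  obtain ⟨h1, h2⟩ := h.KL_ne_top hσ
  refine (EReal.sub_le_sub (iSup_le (V_first_le hσ hF hcc hD hν h ht hB hCBν))
    (le_iInf (le_V_second hσ hF hcc hD hμ h ht hB hCBμ))).trans ?_
  rw [← EReal.coe_sub, EReal.coe_le_coe_iff, toReal_KL_add_KL hν hμ ht h1 h2]
  set A := (KL νs (ν t).prob).toReal
  set A' := (KL μs (μ t).prob).toReal
  have hA : 0 ≤ A := ENNReal.toReal_nonneg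
  have hA' : 0 ≤ A' := ENNReal.toReal_nonneg
  have hsq : √(2 * A) + √(2 * A') ≤ 2 * √(A + A') := by
    refine abs_le_of_sq_le_sq' ?_ (by positivity) |>.2
    rw [mul_pow, Real.sq_sqrt (by positivity)]
    have e1 := Real.sq_sqrt (show 0 ≤ 2 * A by positivity)
    have e2 := Real.sq_sqrt (show 0 ≤ 2 * A' by positivity)
    nlinarith [sq_nonneg (√(2 * A) - √(2 * A'))]
  have := mul_le_mul_of_nonneg_left hsq hB.le
  linarith

end Coupled

end FRGame

/-- The constant `Cσ` depends only on `σ` and on the constants in the assumptions. -/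
theorem theorem2p5 (σ Cν Cμ rν rμ Rν Rμ : ℝ) (hσ : 0 < σ) :
    ∃ Cσ : ℝ, 0 < Cσ ∧
      ∀ (d : ℕ) (X Y : Set (EuclideanSpace ℝ (Fin d))) (_ : MeasurableSet X) (_ : MeasurableSet Y)
        (Uπ : X → ℝ) (Uρ : Y → ℝ) (π : FRGame.ProbDensity X) (ρ : FRGame.ProbDensity Y)
        (_ : FRGame.IsGibbs Uπ π) (_ : FRGame.IsGibbs Uρ ρ)
        (F : ProbabilityMeasure X → ProbabilityMeasure Y → ℝ)
        (Dν : ProbabilityMeasure X → ProbabilityMeasure Y → X → ℝ)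
        (Dμ : ProbabilityMeasure X → ProbabilityMeasure Y → Y → ℝ)
        (_ : FRGame.HasFlatDerivs F Dν Dμ)
        (_ : FRGame.BoundedFlatDerivs Dν Dμ Cν Cμ)
        (_ : FRGame.BoundedSecondFlatDerivs Dν Dμ)
        (ν : ℝ → FRGame.ProbDensity X) (μ : ℝ → FRGame.ProbDensity Y)
        (_ : FRGame.RatioCondition (ν 0) π rν Rν) (_ : FRGame.RatioCondition (μ 0) ρ rμ Rμ)
        (_ : FRGame.IsFisherRaoFlow σ Dν Dμ π ρ ν μ),
        -- differentiability of `t ↦ KL(ν'|ν_t) + KL(μ'|μ_t)` on `[0, ∞)`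
        (∀ (ν' : FRGame.ProbDensity X) (μ' : FRGame.ProbDensity Y),
          (∀ t : ℝ, 0 ≤ t →
            (FRGame.KL ν'.prob (ν t).prob + FRGame.KL μ'.prob (μ t).prob = ⊤ ↔
              FRGame.KL ν'.prob (ν 0).prob + FRGame.KL μ'.prob (μ 0).prob = ⊤)) ∧
          (FRGame.KL ν'.prob (ν 0).prob + FRGame.KL μ'.prob (μ 0).prob ≠ ⊤ →
            DifferentiableOn ℝ
              (fun t => (FRGame.KL ν'.prob (ν t).prob + FRGame.KL μ'.prob (μ t).prob).toReal)
              (Ici 0))) ∧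
        -- `Cσ` bounds the flat derivatives of the regularized payoff along the flow
        (∀ t : ℝ, 0 ≤ t →
          (∀ (m : ProbabilityMeasure Y) (x : X), |FRGame.a σ Dν π (ν t) m x| ≤ Cσ) ∧
          (∀ (m : ProbabilityMeasure X) (y : Y), |FRGame.b σ Dμ ρ m (μ t) y| ≤ Cσ)) ∧
        -- exponential convergence to the mixed Nash equilibrium
        (FRGame.ConvexConcave F Dν Dμ →
          ∀ (νs : ProbabilityMeasure X) (μs : ProbabilityMeasure Y),
            FRGame.IsMNE σ F π.prob ρ.prob νs μs →
            FRGame.KL νs (ν 0).prob + FRGame.KL μs (μ 0).prob ≠ ⊤ ∧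
            ∀ t : ℝ, 0 ≤ t →
              FRGame.KL νs (ν t).prob + FRGame.KL μs (μ t).prob ≤
                ENNReal.ofReal (Real.exp (-(σ ^ 2 / 2 * t))) *
                  (FRGame.KL νs (ν 0).prob + FRGame.KL μs (μ 0).prob) ∧
              0 ≤ FRGame.NI σ F π.prob ρ.prob (ν t).prob (μ t).prob ∧
              FRGame.NI σ F π.prob ρ.prob (ν t).prob (μ t).prob ≤
                ((2 * Cσ * Real.exp (-(σ ^ 2 / 4 * t)) *
                  √((FRGame.KL νs (ν 0).prob + FRGame.KL μs (μ 0).prob).toReal) : ℝ) : EReal)) := by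
  set s := σ ^ 2 / 2 with hs
  have hs0 : 0 < s := by positivity
  -- absolute values make the constant positive for arbitrary real parameters
  set Lν := FRGame.logRatioBound s |Cν| rν Rν with hLν
  set Lμ := FRGame.logRatioBound s |Cμ| rμ Rμ with hLμ
  have hLν0 : 0 < Lν := by rw [hLν, FRGame.logRatioBound]; positivity
  have hLμ0 : 0 < Lμ := by rw [hLμ, FRGame.logRatioBound]; positivity
  have hCσ : 0 < |Cν| + |Cμ| + 2 * s * (Lν + Lμ) := by positivity
  refine ⟨|Cν| + |Cμ| + 2 * s * (Lν + Lμ), hCσ, ?_⟩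
  intro d X Y _ _ Uπ Uρ π ρ hπ hρ F Dν Dμ hF hD _ ν μ hrν hrμ hflow
  rw [abs_of_pos hD.1] at *
  rw [abs_of_pos hD.2.1] at *
  have hν := hflow.isEntropicPath_first hσ hπ.pos hD hrν
  have hμ := hflow.isEntropicPath_second hσ hρ.pos hD hrμ
  rw [← hs] at hν hμ
  have hsν : 0 < s * Lν := mul_pos hs0 hLν0
  have hsμ : 0 < s * Lμ := mul_pos hs0 hLμ0
  have hCν := hD.1
  have hCμ := hD.2.1
  refine ⟨fun ν' μ' => ⟨fun t ht => ?_, fun hfin => ?_⟩, fun t ht => ⟨fun m x => ?_, fun m y => ?_⟩,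
    fun hcc νs μs hMNE => ?_⟩
  · rw [FRGame.KL_add_KL_eq_top_iff hν hμ ht, FRGame.KL_add_KL_eq_top_iff hν hμ le_rfl]
  · rw [Ne, FRGame.KL_add_KL_eq_top_iff hν hμ le_rfl, not_or] at hfin
    exact fun t ht => (FRGame.hasDerivWithinAt_toReal_KL_add_KL hν hμ ht hfin.1
      hfin.2).differentiableWithinAt
  · refine (hν.abs_add_le ht x (hD.2.2.1 (ν t).prob m x)).trans ?_
    rw [← hLν]
    linarith
  · have h1 := hμ.abs_add_le ht y
      ((abs_neg (Dμ m (μ t).prob y)).trans_le (hD.2.2.2 m (μ t).prob y))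
    rw [← abs_neg, ← hLμ] at h1
    have h2 : FRGame.b σ Dμ ρ m (μ t) y = -(-Dμ m (μ t).prob y +
        s * FRGame.logRatio (μ t) ρ y - s * (FRGame.KL (μ t).prob ρ.prob).toReal) := by
      simp only [FRGame.b, FRGame.logRatio]
      ring
    rw [h2]
    linarith
  · obtain ⟨hνs, hμs⟩ := hMNE.KL_ne_top hσ
    have hfin : ∀ t, 0 ≤ t → FRGame.KL νs (ν t).prob + FRGame.KL μs (μ t).prob ≠ ⊤ := fun t ht =>
      mt (FRGame.KL_add_KL_eq_top_iff hν hμ ht).1 (not_or.2 ⟨hνs, hμs⟩)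
    refine ⟨hfin 0 le_rfl, fun t ht => ?_⟩
    have hdecay := FRGame.le_exp_mul_of_deriv_le (s := s)
      (fun t ht => FRGame.hasDerivWithinAt_toReal_KL_add_KL hν hμ ht hνs hμs)
      (fun t ht => FRGame.velocity_le hσ hF hcc hν hμ hMNE ht) ht
    refine ⟨?_, FRGame.NI_nonneg (hν.KL_ref_ne_top ht) (hμ.KL_ref_ne_top ht), ?_⟩
    · rw [← ENNReal.ofReal_toReal (hfin t ht), ← ENNReal.ofReal_toReal (hfin 0 le_rfl),
        ← ENNReal.ofReal_mul (Real.exp_pos _).le]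
      exact ENNReal.ofReal_le_ofReal hdecay
    · refine (FRGame.NI_le hσ hF hcc hD hν hμ hMNE ht hCσ
        (by rw [← hs, ← hLν]; linarith) (by rw [← hs, ← hLμ]; linarith)).trans ?_
      rw [EReal.coe_le_coe_iff, mul_assoc (2 * _) (Real.exp _)]
      refine mul_le_mul_of_nonneg_left ((Real.sqrt_le_sqrt hdecay).trans_eq ?_) (by positivity)
      rw [Real.sqrt_mul (Real.exp_pos _).le, ← Real.exp_half]
      congr 2
      rw [hs]
      ring
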